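/- **Setting.** Let $G=(V,E,x,z)$ be a finite simple undirected graph with node attributes $x:V\to\mathbb R^{d}$ and edge attributes $z:E\to\mathbb R^{d'}$, and let $\ell\ge 0$. Let $\mathcal W_\ell(G)$ be the set of walks of length $\ell$, i.e. sequences $W=(w_0,\dots,w_\ell)\in V^{\ell+1}$ with $w_{i-1}w_i\in E$ for $1\le i\le \ell$. The walk feature vector $X_W\in\mathbb R^{(\ell+1)\times d_{\mathrm{walk}}}$ of $W$ is the matrix whose $i$-th row ($0\le i\le \ell$) is the concatenation of $x(w_i)$, of $z(w_iw_{i+1})$ (read as $0$ for $i=\ell$), and of the encodings $\mathrm{id}_W[i,j],\mathrm{adj}_W[i,j]\in\{0,1\}$ for $0\le j\le \ell-1$, where $\mathrm{id}_W[i,j]=1$ iff $i-j\ge 1$ and $w_i=w_{i-j-1}$, and $\mathrm{adj}_W[i,j]=1$ iff $i-j\ge 1$ and $w_iw_{i-j-1}\in E$. Let $P=P(\mathcal W_\ell(G))$ be the distribution from which walks are sampled: the law of the first $\ell$ steps of the random walk (each step goes to a uniformly chosen neighbor of the current node), or of the non-backtracking random walk (each step goes to a uniformly chosen element of $\mathcal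 N(w_i)\setminus\{w_{i-1}\}$), with an arbitrary initial distribution $P_0$ on $V$, provided that the walk almost surely does not get stuck within these $\ell$ steps; or any other probability distribution on $\mathcal W_\ell(G)$. Let $W_1,W_2,\dots$ be i.i.d. with distribution $P$, and for a function $f:\mathbb R^{(\ell+1)\times d_{\mathrm{walk}}}\to\mathbb R$ put $$g_{f,m,\ell}(G)=\frac1m\sum_{j=1}^m f(X_{W_j}),\qquad g_{f,\ell}(G)=\mathbb E_{W\sim P}[f(X_W)].$$ **Theorem (Convergence rate).** Assume that $\mathrm{Var}_{W\sim P}[f(X_W)]=\sigma^2<\infty$ with $\sigma\ge 0$. Then, as $m\to\infty$, $$\sqrt m\,\bigl(g_{f,m,\ell}(G)-g_{f,\ell}(G)\bigr)\xrightarrow{\;d\;}\mathcal N(0,\sigma^2),$$ where $\mathcal N(0,0)$ is the Dirac mass at $0$. -/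

import Mathlib

open MeasureTheory ProbabilityTheory Filter
open scoped NNReal ENNReal

noncomputable section

namespace NeuralWalker

/-- A graph `G = (V, E, x, z)` with node attributes `x : V → ℝ^dV` and edge attributes
`z : E → ℝ^dE`. -/
structure AttributedGraph (V : Type*) (dV dE : ℕ) where
  /-- the set of edges -/
  graph : SimpleGraph V
  /-- the node attributes -/
  x : V → Fin dV → ℝ
  /-- the edge attributes -/
  z : graph.edgeSet → Fin dE → ℝ

variable {V : Type*} {dV dE : ℕ}

/-- The set `𝒲_ℓ(G)` of walks of length `ℓ`: sequences `(w₀, …, w_ℓ)` of nodes such that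
consecutive nodes are linked by an edge. -/
structure Walks (G : AttributedGraph V dV dE) (ℓ : ℕ) where
  /-- the nodes of the walk -/
  node : Fin (ℓ + 1) → V
  /-- consecutive nodes are linked by an edge -/
  adj : ∀ i : Fin ℓ, G.graph.Adj (node i.castSucc) (node i.succ)

/-- Every set of walks is measurable. -/
instance (G : AttributedGraph V dV dE) (ℓ : ℕ) : MeasurableSpace (Walks G ℓ) := ⊤

section Features

variable {G : AttributedGraph V dV dE} {ℓ : ℕ}

open Classical in
/-- The identity encoding of window size `s`: the entry `[i, j]` is `1` if `i - j ≥ 1` and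
`w_i = w_{i-j-1}`, and `0` otherwise. -/
def idEncoding (w : Walks G ℓ) (s : ℕ) : Matrix (Fin (ℓ + 1)) (Fin s) ℝ :=
  fun i j ↦ if ∃ k : Fin (ℓ + 1), (k : ℕ) + j + 1 = i ∧ w.node i = w.node k then 1 else 0

open Classical in
/-- The adjacency encoding of window size `s`: the entry `[i, j]` is `1` if `i - j ≥ 1` and
`w_i w_{i-j-1}` is an edge, and `0` otherwise. -/
def adjEncoding (w : Walks G ℓ) (s : ℕ) : Matrix (Fin (ℓ + 1)) (Fin s) ℝ :=
  fun i j ↦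
    if ∃ k : Fin (ℓ + 1), (k : ℕ) + j + 1 = i ∧ G.graph.Adj (w.node i) (w.node k) then 1 else 0

/-- The attribute `z(w_i w_{i+1})` of the `i`-th edge of a walk, with `z(w_ℓ w_{ℓ+1}) = 0`. -/
def edgeFeature (w : Walks G ℓ) (i : Fin (ℓ + 1)) : Fin dE → ℝ :=
  if h : (i : ℕ) < ℓ then
    G.z ⟨s(w.node (Fin.castSucc ⟨i, h⟩), w.node (Fin.succ ⟨i, h⟩)), w.adj ⟨i, h⟩⟩
  else 0

/-- Column indices of a walk feature vector: node attributes, edge attributes, and the identity and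
adjacency encodings of window size `ℓ`. -/
abbrev WalkCols (dV dE ℓ : ℕ) : Type := Fin dV ⊕ Fin dE ⊕ Fin ℓ ⊕ Fin ℓ

/-- The space of real `(ℓ + 1) × d_walk` matrices that walk feature vectors live in. -/
abbrev WalkFeatures (dV dE ℓ : ℕ) : Type := Matrix (Fin (ℓ + 1)) (WalkCols dV dE ℓ) ℝ

/-- The walk feature vector `X_W`: its `i`-th row is the concatenation of `x(w_i)`,
`z(w_i w_{i+1})` and the `i`-th rows of the positional encodings of window size `ℓ`. -/
def walkFeature (w : Walks G ℓ) : WalkFeatures dV dE ℓ :=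
  fun i ↦ Sum.elim (G.x (w.node i)) (Sum.elim (edgeFeature w i)
    (Sum.elim (idEncoding w ℓ i) (adjEncoding w ℓ i)))

end Features

section Sampling

variable (G : AttributedGraph V dV dE) (ℓ : ℕ)

/-- The nodes to which a random walk may move after `w_i`: the neighbors of `w_i`. -/
def nextNodes {G : AttributedGraph V dV dE} {ℓ : ℕ} (w : Walks G ℓ) (i : Fin ℓ) : Set V :=
  G.graph.neighborSet (w.node i.castSucc)

/-- The nodes to which a non-backtracking random walk may move after `w_i`: the neighbors of `w_i`
other than `w_{i-1}` (all neighbors if `i = 0`). -/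
def nextNodesNB {G : AttributedGraph V dV dE} {ℓ : ℕ} (w : Walks G ℓ) (i : Fin ℓ) : Set V :=
  {v ∈ G.graph.neighborSet (w.node i.castSucc) |
    ∀ k : Fin (ℓ + 1), (k : ℕ) + 1 = i → v ≠ w.node k}

open Classical in
/-- The law on walks of length `ℓ` of the random sequence whose first node has distribution `P₀`
and whose `(i+1)`-st node is uniform on the finite set `next w i`, given the nodes up to `w_i`.
It is a probability measure precisely when almost surely none of these sets is empty. -/
def chainLaw (next : Walks G ℓ → Fin ℓ → Set V) (P₀ : PMF V) : Measure (Walks G ℓ) :=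
  Measure.sum fun w ↦
    (P₀ (w.node 0) * ∏ i : Fin ℓ,
      if w.node i.succ ∈ next w i then ((next w i).ncard : ℝ≥0∞)⁻¹ else 0) • Measure.dirac w

/-- A random walk sampler. -/
inductive Sampler where
  /-- the random walk with initial distribution `P₀` -/
  | randomWalk (P₀ : PMF V)
  /-- the non-backtracking random walk with initial distribution `P₀` -/
  | nonBacktracking (P₀ : PMF V)
  /-- any other probability distribution on the walks of length `ℓ` -/
  | other (P : PMF (Walks G ℓ))

variable {G ℓ}

/-- The distribution `P(𝒲_ℓ(G))` of a walk drawn by the sampler. -/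
def Sampler.law : Sampler G ℓ → Measure (Walks G ℓ)
  | .randomWalk P₀ => chainLaw G ℓ nextNodes P₀
  | .nonBacktracking P₀ => chainLaw G ℓ nextNodesNB P₀
  | .other P => P.toMeasure

/-- The average `g_{f,m,ℓ}(G)` of `f` over the feature vectors of `m` sampled walks. -/
def empiricalAverage (f : WalkFeatures dV dE ℓ → ℝ) {m : ℕ} (W : Fin m → Walks G ℓ) : ℝ :=
  (1 / (m : ℝ)) * ∑ j, f (walkFeature (W j))

/-- The expectation `g_{f,ℓ}(G)` of `f(X_W)` for a walk `W` with distribution `P`. -/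
def expectedValue (f : WalkFeatures dV dE ℓ → ℝ) (P : Measure (Walks G ℓ)) : ℝ :=
  ∫ w, f (walkFeature w) ∂P

end Sampling

end NeuralWalker

end

namespace ProbabilityTheory

/-! The numbers `f (X_{W_j})` are i.i.d. real variables with finite variance, so this is the
classical central limit theorem, `tendstoInDistribution_inv_sqrt_mul_sum_sub`, after rewriting `√m
(s/m - c)` as `(s - m c)/√m`. The sampling scheme matters only through the common law of the walks.
The case `σ = 0` needs no separate argument. -/

/-- **Central limit theorem** for empirical means of a function of i.i.d. random variables: if
`W₀, W₁, …` are independent with law `P` and `h` is square-integrable with respect to `P`, then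
`√m ((1/m) ∑_{j<m} h(W_j) - ∫ h dP)` converges in distribution to a centered Gaussian with the
variance of `h` under `P`. -/
theorem tendstoInDistribution_sqrt_mul_average_sub_integral {E Ω : Type*} [MeasurableSpace E]
    [MeasurableSpace Ω] {μ : Measure Ω} [IsProbabilityMeasure μ] {P : Measure E} {W : ℕ → Ω → E}
    (hlaw : ∀ j, HasLaw (W j) P μ) (hindep : iIndepFun W μ) {h : E → ℝ} (hm : Measurable h)
    (hL2 : MemLp h 2 P) :
    TendstoInDistribution
      (fun (m : ℕ) (ω : Ω) ↦ √(m : ℝ) * ((1 / (m : ℝ)) * ∑ j : Fin m, h (W j ω) - ∫ x, h x ∂P))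
      atTop (id : ℝ → ℝ) (fun _ ↦ μ) (gaussianReal 0 Var[h; P].toNNReal) := by
  have hvar : Var[fun ω ↦ h (W 0 ω); μ] = Var[h; P] := by
    rw [← (hlaw 0).map_eq, variance_map hm.aemeasurable (hlaw 0).aemeasurable]
    rfl
  have hmean : ∫ ω, h (W 0 ω) ∂μ = ∫ x, h x ∂P :=
    (hlaw 0).integral_comp hm.aestronglyMeasurable
  have hmemLp : MemLp (fun ω ↦ h (W 0 ω)) 2 μ := by
    rw [← (hlaw 0).map_eq] at hL2
    exact hL2.comp_of_map (hlaw 0).aemeasurable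
  have hclt := tendstoInDistribution_inv_sqrt_mul_sum_sub (P := μ)
    (X := fun j ω ↦ h (W j ω)) (Y := (id : ℝ → ℝ)) (P' := gaussianReal 0 Var[h; P].toNNReal)
    (by rw [hvar]; exact HasLaw.id) hmemLp (hindep.comp (fun _ ↦ h) fun _ ↦ hm)
    (fun j ↦ ((hlaw j).identDistrib (hlaw 0)).comp hm)
  convert! hclt using 3 with m ω
  rw [hmean, Finset.sum_range]
  rcases Nat.eq_zero_or_pos m with rfl | hpos
  -- At `m = 0` both expressions vanish, since `√0 = 0` and `0⁻¹ = 0`.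
  · simp
  have hm0 : (0 : ℝ) < m := by exact_mod_cast hpos
  have hsq : √(m : ℝ) * √(m : ℝ) = m := Real.mul_self_sqrt hm0.le
  have hne : √(m : ℝ) ≠ 0 := (Real.sqrt_pos.2 hm0).ne'
  have key (s c : ℝ) : √(m : ℝ) * (1 / m * s - c) = (√(m : ℝ))⁻¹ * (s - m * c) := by
    -- This also rewrites the `m` under each root; the next line undoes that, leaving a rational
    -- identity in `√m`.
    rw [← hsq]
    simp only [Real.sqrt_mul_self (Real.sqrt_nonneg _)]
    field_simp
  exact key _ _

end ProbabilityTheory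

theorem mainTheorem4 {V : Type*} [Finite V] {dV dE ℓ : ℕ}
    (G : NeuralWalker.AttributedGraph V dV dE) (S : NeuralWalker.Sampler G ℓ)
    (f : NeuralWalker.WalkFeatures dV dE ℓ → ℝ)
    (σ : ℝ≥0)
    (hσ : evariance (fun w ↦ f (NeuralWalker.walkFeature w)) S.law = ((σ ^ 2 : ℝ≥0) : ℝ≥0∞))
    {Ω : Type*} [MeasurableSpace Ω] (μ : Measure Ω) [IsProbabilityMeasure μ]
    (W : ℕ → Ω → NeuralWalker.Walks G ℓ)
    (hlaw : ∀ j, HasLaw (W j) S.law μ) (hindep : iIndepFun W μ) :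
    TendstoInDistribution
      (fun (m : ℕ) (ω : Ω) ↦ √(m : ℝ) *
        (NeuralWalker.empiricalAverage f (fun j : Fin m ↦ W j ω)
          - NeuralWalker.expectedValue f S.law))
      atTop (id : ℝ → ℝ) (fun _ ↦ μ) (gaussianReal 0 (σ ^ 2)) := by
  -- A chain that can get stuck has total mass below `1`; being the law of a variable on a
  -- probability space rules this out.
  have hprob : IsProbabilityMeasure S.law := (hlaw 0).isProbabilityMeasure_iff.1 inferInstance
  have hm : Measurable fun w : NeuralWalker.Walks G ℓ ↦ f (NeuralWalker.walkFeature w) :=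
    measurable_from_top
  -- A finite extended variance already forces square integrability, hence a genuine mean.
  have hL2 : MemLp (fun w ↦ f (NeuralWalker.walkFeature w)) 2 S.law :=
    (evariance_lt_top_iff_memLp hm.aestronglyMeasurable).1 (hσ ▸ ENNReal.coe_lt_top)
  have hvar : Var[fun w ↦ f (NeuralWalker.walkFeature w); S.law].toNNReal = σ ^ 2 := by
    rw [variance, hσ, ENNReal.coe_toReal, Real.toNNReal_coe]
  rw [← hvar]
  exact tendstoInDistribution_sqrt_mul_average_sub_integral hlaw hindep hm hL2
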